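/- Let $N\ge 2$ be an integer, let $m>0$, and let $V\colon\mathbb{R}^N\to\mathbb{R}$ be continuous and bounded below. Let $L^{1/2,2}(\mathbb{R}^N)$ be the Bessel potential space of all $u\in L^2(\mathbb{R}^N)$ (complex valued) with $(I-\Delta)^{1/4}u\in L^2(\mathbb{R}^N)$, where $(-\Delta+m^2)^{1/4}$ and $(I-\Delta)^{1/4}$ are defined as Fourier multipliers, and for an open set $\Omega\subset\mathbb{R}^N$ let $L^{1/2,2}(\Omega)$ be the space of the restrictions to $\Omega$ of the functions in $L^{1/2,2}(\mathbb{R}^N)$. For $t\ge 2$ put $$\nu(t,\Omega)=\inf_{\substack{u\in L^{1/2,2}(\Omega)\\ u\ne 0}}\frac{\|u\|_{1/2,\Omega}^2+\int_\Omega V|u|^2}{\left(\int_\Omega|u|^t\right)^{2/t}},\qquad \|u\|_{1/2,\Omega}^2=\inf\left\{\int_{\mathbb{R}^N}\left|(-\Delta+m^2)^{1/4}U\right|^2 \;:\; U\in L^{1/2,2}(\mathbb{R}^N),\ U|_\Omega=u\right\},$$ $$\nu_0(t,\Omega)=\inf_{\substack{u\in L^{1/2,2}(\mathbb{R}^N),\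 u\ne 0\\ u=0\text{ a.e. outside }\Omega}}\frac{\int_\Omega\left|(-\Delta+m^2)^{1/4}u\right|^2+\int_\Omega V|u|^2}{\left(\int_\Omega|u|^t\right)^{2/t}},$$ where $\int_\Omega V|u|^2\in(-\infty,+\infty]$ and $\nu(t,\emptyset)=\nu_0(t,\emptyset)=+\infty$. Let $B_R=\{x\in\mathbb{R}^N : |x|<R\}$. Suppose that condition $(\nu')$ holds: for every $b>0$ the set $V^b=\{x\in\mathbb{R}^N : V(x)<b\}$ has finite Lebesgue measure. Then condition $(\nu)$ holds, for $\nu$ as well as for $\nu_0$: there exists $t_0\in\left[2,\frac{2N}{N-1}\right)$ such that $$\lim_{R\to+\infty}\nu\left(t_0,\mathbb{R}^N\setminus\overline{B_R}\right)=+\infty\qquad\text{and}\qquad \lim_{R\to+\infty}\nu_0\left(t_0,\mathbb{R}^N\setminus\overline{B_R}\right)=+\infty .$$ -/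

import Mathlib

open MeasureTheory Filter Topology
open scoped FourierTransform SchwartzMap ENNReal

noncomputable section

namespace Semirelativistic

/-- `ℝ^N` with its Euclidean norm. -/
abbrev Space (N : ℕ) : Type := EuclideanSpace ℝ (Fin N)

/-- The (complex) Hilbert space `L²(ℝ^N)`. -/
abbrev L2 (N : ℕ) : Type := Lp ℂ 2 (volume : Measure (Space N))

/-- Membership of `u ∈ L²(ℝ^N)` in the Bessel potential space `L^{1/2,2}(ℝ^N)`. -/
def MemBessel {N : ℕ} (u : L2 N) : Prop :=
  TemperedDistribution.MemSobolev (1 / 2) 2 (u : 𝓢'(Space N, ℂ))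

/-- The Fourier symbol `(|2πξ|² + m²)^{1/4}` of the operator `(-Δ + m²)^{1/4}`; the factor `2π`
comes from the normalization `𝓕 u ξ = ∫ exp (-2πi x·ξ) u x dx`. -/
def symbol {N : ℕ} (m : ℝ) (ξ : Space N) : ℝ :=
  ((2 * Real.pi * ‖ξ‖) ^ 2 + m ^ 2) ^ (1 / 4 : ℝ)

open Classical in
/-- The operator `(-Δ + m²)^{1/4} = 𝓕⁻¹ ∘ (|2πξ|² + m²)^{1/4} ∘ 𝓕`, with domain those `u ∈ L²` for
which the result is in `L²` (it contains `L^{1/2,2}(ℝ^N)`, see `MemBessel.memLp_symbol_mul`);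
the value outside of the domain is irrelevant. -/
def rootOp {N : ℕ} (m : ℝ) (u : L2 N) : L2 N :=
  if h : MemLp (fun ξ => (symbol m ξ : ℂ) * (𝓕 u : L2 N) ξ) 2 (volume : Measure (Space N)) then
    𝓕⁻ (h.toLp _)
  else 0

/-- For `u ∈ L^{1/2,2}(ℝ^N)` the function `(|2πξ|² + m²)^{1/4} 𝓕u` is in `L²`, so that
`rootOp m u` is given by the Fourier multiplier. -/
theorem MemBessel.memLp_symbol_mul {N : ℕ} (m : ℝ) {u : L2 N} (hu : MemBessel u) :
    MemLp (fun ξ => (symbol m ξ : ℂ) * (𝓕 u : L2 N) ξ) 2 (volume : Measure (Space N)) := by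
  obtain ⟨f', hf'⟩ :=
    TemperedDistribution.memSobolev_iff_exists_smulLeftCLM_fourier.mp hu
  rw [Lp.fourier_toTemperedDistribution_eq] at hf'
  -- the bounded inverse of the Bessel symbol
  set g : Space N → ℂ := fun ξ => (((1 + ‖ξ‖ ^ 2) ^ (-(1 / 2 / 2) : ℝ) : ℝ) : ℂ) with hg
  have hgt : g.HasTemperateGrowth := by fun_prop
  have hgb : ∀ ξ, ‖g ξ‖ ≤ 1 := fun ξ => by
    rw [hg, Complex.norm_real, Real.norm_eq_abs, abs_of_nonneg (by positivity)]
    exact Real.rpow_le_one_of_one_le_of_nonpos (by simp) (by norm_num)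
  have hgm : MemLp g ∞ (volume : Measure (Space N)) :=
    memLp_top_of_bound hgt.1.continuous.aestronglyMeasurable 1 (ae_of_all _ hgb)
  have key : (hgm.toLp g) • f' = (𝓕 u : L2 N) := by
    have hinj : Function.Injective
        (Lp.toTemperedDistributionCLM ℂ (volume : Measure (Space N)) 2) :=
      LinearMap.ker_eq_bot.mp Lp.ker_toTemperedDistributionCLM_eq_bot
    apply hinj
    rw [Lp.toTemperedDistributionCLM_apply, Lp.toTemperedDistributionCLM_apply,
      Lp.toTemperedDistribution_smul_eq hgt hgm f', ← hf',
      TemperedDistribution.smulLeftCLM_smulLeftCLM_apply (by fun_prop) hgt]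
    have hone : (fun x : Space N => (((1 + ‖x‖ ^ 2) ^ (1 / 2 / 2 : ℝ) : ℝ) : ℂ)) * g
        = fun _ => 1 := by
      ext x
      simp only [Pi.mul_apply, hg]
      rw [← Complex.ofReal_mul, ← Real.rpow_add (by positivity)]
      simp
    rw [hone]
    simp
  have hae : ∀ᵐ ξ, (𝓕 u : L2 N) ξ = g ξ * f' ξ := by
    rw [← key]
    filter_upwards [Lp.coeFn_lpSMul (r := 2) (hgm.toLp g) f', hgm.coeFn_toLp] with x h1 h2
    rw [h1, Pi.smul_apply', h2, smul_eq_mul]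
  have hsc : Continuous (symbol m : Space N → ℝ) := by
    unfold symbol
    exact Continuous.rpow_const (by fun_prop) (fun _ => Or.inr (by norm_num))
  refine MemLp.of_le_mul (c := ((2 * Real.pi) ^ 2 + m ^ 2) ^ (1 / 4 : ℝ)) (Lp.memLp f') ?_ ?_
  · exact (Complex.continuous_ofReal.comp hsc).aestronglyMeasurable.mul
      (Lp.memLp (𝓕 u : L2 N)).1
  · filter_upwards [hae] with ξ h
    rw [h, ← mul_assoc, norm_mul]
    gcongr
    have h0 : (0 : ℝ) ≤ symbol m ξ := by unfold symbol; positivity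
    rw [norm_mul, hg, Complex.norm_real, Complex.norm_real, Real.norm_eq_abs, Real.norm_eq_abs,
      abs_of_nonneg h0, abs_of_nonneg (by positivity), Real.rpow_neg (by positivity),
      mul_inv_le_iff₀ (by positivity), symbol]
    norm_num only
    rw [← Real.mul_rpow (by positivity) (by positivity)]
    gcongr
    nlinarith [sq_nonneg (m * ‖ξ‖), Real.pi_pos, sq_nonneg Real.pi, sq_nonneg ‖ξ‖]

/-- `∫_Ω |(-Δ + m²)^{1/4} u|²` for `u` on the whole space, as an element of `[0, ∞]`. -/
def kinetic {N : ℕ} (m : ℝ) (Ω : Set (Space N)) (u : L2 N) : ℝ≥0∞ :=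
  ∫⁻ x in Ω, ‖rootOp m u x‖ₑ ^ 2

/-- `∫_Ω V |u|²`, as the integral of the positive part minus the integral of the negative part. It
lies in `(-∞, ∞]` if `V` is bounded below and `u ∈ L²(Ω)`. -/
def potential {N : ℕ} (V : Space N → ℝ) (Ω : Set (Space N)) (u : Space N → ℂ) : EReal :=
  ((∫⁻ x in Ω, ENNReal.ofReal (V x) * ‖u x‖ₑ ^ 2 : ℝ≥0∞) : EReal)
    - ((∫⁻ x in Ω, ENNReal.ofReal (-V x) * ‖u x‖ₑ ^ 2 : ℝ≥0∞) : EReal)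

/-- `(∫_Ω |u|^t)^{2/t}`. -/
def sqNorm {N : ℕ} (t : ℝ) (Ω : Set (Space N)) (u : Space N → ℂ) : ℝ≥0∞ :=
  (∫⁻ x in Ω, ‖u x‖ₑ ^ t) ^ (2 / t)

/-- `U` is a function in `L^{1/2,2}(ℝ^N)` whose restriction to `Ω` is `u`. -/
def IsExtension {N : ℕ} (Ω : Set (Space N)) (u : Lp ℂ 2 (volume.restrict Ω)) (U : L2 N) : Prop :=
  MemBessel U ∧ U =ᵐ[volume.restrict Ω] u

/-- `L^{1/2,2}(Ω)`: the restrictions to `Ω` of the functions in `L^{1/2,2}(ℝ^N)`. -/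
def MemBesselOn {N : ℕ} (Ω : Set (Space N)) (u : Lp ℂ 2 (volume.restrict Ω)) : Prop :=
  ∃ U : L2 N, IsExtension Ω u U

/-- The square of the norm of `L^{1/2,2}(Ω)` as a space of restrictions:
the least value of `∫_{ℝ^N} |(-Δ + m²)^{1/4} U|²` over all extensions `U` of `u`. -/
def kineticOn {N : ℕ} (m : ℝ) (Ω : Set (Space N)) (u : Lp ℂ 2 (volume.restrict Ω)) : ℝ≥0∞ :=
  ⨅ (U : L2 N) (_ : IsExtension Ω u U), kinetic m Set.univ U

/-- `ν(t, Ω)` with `u` ranging over the restrictions to `Ω` of functions in `L^{1/2,2}(ℝ^N)`.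
It is `+∞` for `Ω = ∅`, the infimum being taken over the empty set. -/
def nu {N : ℕ} (m : ℝ) (V : Space N → ℝ) (t : ℝ) (Ω : Set (Space N)) : EReal :=
  ⨅ (u : Lp ℂ 2 (volume.restrict Ω)) (_ : MemBesselOn Ω u ∧ u ≠ 0),
    ((kineticOn m Ω u : EReal) + potential V Ω u) / (sqNorm t Ω u : EReal)

/-- `ν₀(t, Ω)` with `u` ranging over the functions in `L^{1/2,2}(ℝ^N)` that vanish almost everywhere
outside of `Ω`, and with both integrals in the numerator taken over `Ω` only.
It is `+∞` for `Ω = ∅`, the infimum being taken over the empty set. -/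
def nuZero {N : ℕ} (m : ℝ) (V : Space N → ℝ) (t : ℝ) (Ω : Set (Space N)) : EReal :=
  ⨅ (u : L2 N) (_ : MemBessel u ∧ (∀ᵐ x ∂volume, x ∉ Ω → u x = 0) ∧ u ≠ 0),
    ((kinetic m Ω u : EReal) + potential V Ω u) / (sqNorm t Ω u : EReal)

end Semirelativistic

end

/-! The exponent `t₀ = 2` works. Let `V ≥ -c`, `b > 0` and `A = {V < b} ∩ Ω`. Since `V ≥ b` on `Ω \
A`, one has `∫_Ω V|u|² ≥ b ∫_Ω |u|² - (b + c) ∫_A |u|²`, so the quotient is at least `b` once `(b +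
c) ∫_A |u|²` is bounded by the kinetic term (`le_quotient`). For `Ω` the exterior of a large ball,
`A` has small measure, because `{V < b}` has finite measure.

It remains to bound the mass on small sets by the kinetic term. Split `u` at a frequency cutoff: the
low part is bounded by Cauchy–Schwarz on the Fourier side, hence has little mass on `A`; the high
part is small in `L²` relative to the energy (`setLIntegral_enorm_sq_le`).

For `nuZero` the kinetic term is an integral over `Ω` only, although `T u`, with `T = (-Δ +
m²)^{1/4}`, need not vanish outside. The form `q = ⟨u, T u⟩` gets around this: as `u = 0` off `Ω`,
`q² ≤ ‖u‖² ∫_Ω |T u|²`, and `q ≥ √m ‖u‖²`, so `√m q ≤ ∫_Ω |T u|²`. The form `q` has symbol growing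
like `|ξ|^{1/2}`, which suffices for the high frequencies. The case of `nu` is `Ω = ℝ^N`. -/

namespace Semirelativistic

/-! ### Fourier inversion and equi-integrability -/

/-- On `L¹ ∩ L²` the inverse Fourier transform of `L²` is given by the Fourier integral. -/
theorem coeFn_fourierInv_ae_eq {N : ℕ} (g : L2 N) (hg : Integrable g) :
    ((𝓕⁻ g : L2 N) : Space N → ℂ) =ᵐ[volume] 𝓕⁻ (g : Space N → ℂ) := by
  have hcont : Continuous (𝓕⁻ (g : Space N → ℂ)) :=
    VectorFourier.fourierIntegral_continuous Real.continuous_fourierChar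
      (L := -innerₗ (Space N)) (by exact (continuous_inner (𝕜 := ℝ) (E := Space N)).neg) hg
  refine ae_eq_of_integral_contDiff_smul_eq
    ((Lp.memLp (𝓕⁻ g : L2 N)).locallyIntegrable (by norm_num)) hcont.locallyIntegrable
    fun φ hφ hφc => ?_
  have h₁ : HasCompactSupport (Complex.ofRealCLM ∘ φ) := hφc.comp_left rfl
  have h₂ : ContDiff ℝ (⊤ : ℕ∞) (Complex.ofRealCLM ∘ φ) := Complex.ofRealCLM.contDiff.comp hφ
  set ψ : 𝓢(Space N, ℂ) := h₁.toSchwartzMap h₂ with hψ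
  have hψφ : ∀ x, ψ x = (φ x : ℂ) := fun x => rfl
  have h := congrArg (fun T : 𝓢'(Space N, ℂ) => T ψ) (Lp.fourierInv_toTemperedDistribution_eq g)
  simp only [TemperedDistribution.fourierInv_apply, Lp.toTemperedDistribution_apply,
    SchwartzMap.fourierInv_coe] at h
  -- Fubini moves the Fourier integral from the test function to `g`; the kernel is symmetric, so
  -- flipping the pairing changes nothing.
  have hflip := VectorFourier.integral_fourierIntegral_smul_eq_flip (L := -innerₗ (Space N))
    (μ := volume) (ν := volume) (f := ψ) (g := g) Real.continuous_fourierChar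
    (by exact (continuous_inner (𝕜 := ℝ) (E := Space N)).neg) ψ.integrable hg
  have hL : (-innerₗ (Space N)).flip = -innerₗ (Space N) := by
    ext x y; simp [real_inner_comm]
  rw [hL] at hflip
  have h3 : ∫ x, ψ x • (𝓕⁻ g : L2 N) x = ∫ x, ψ x • 𝓕⁻ (g : Space N → ℂ) x :=
    h.symm.trans hflip
  simpa only [hψφ, Complex.coe_smul] using h3

/-- The inverse Fourier transform maps `L¹ ∩ L²` to bounded functions. -/
theorem enorm_fourierInv_ae_le {N : ℕ} (g : L2 N) (hg : Integrable g) :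
    ∀ᵐ x, ‖(𝓕⁻ g : L2 N) x‖ₑ ≤ ∫⁻ ξ, ‖g ξ‖ₑ := by
  filter_upwards [coeFn_fourierInv_ae_eq g hg] with x hx
  rw [hx, Real.fourierInv_eq]
  refine (enorm_integral_le_lintegral_enorm _).trans (le_of_eq ?_)
  refine lintegral_congr fun ξ => ?_
  rw [← ofReal_norm, ← ofReal_norm, Circle.norm_smul]

/-- The square of the norm of `L²` as an integral. -/
theorem enorm_sq_eq_lintegral {α : Type*} [MeasurableSpace α] {μ : Measure α} (f : Lp ℂ 2 μ) :
    ‖f‖ₑ ^ 2 = ∫⁻ x, ‖f x‖ₑ ^ 2 ∂μ := by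
  rw [Lp.enorm_def]
  have := eLpNorm_nnreal_pow_eq_lintegral (f := f) (μ := μ) (p := 2) (by norm_num)
  simpa using this

theorem lintegral_enorm_sq_fourier {N : ℕ} (u : L2 N) :
    ∫⁻ ξ, ‖(𝓕 u : L2 N) ξ‖ₑ ^ 2 = ∫⁻ x, ‖u x‖ₑ ^ 2 := by
  rw [← enorm_sq_eq_lintegral, ← enorm_sq_eq_lintegral, ← ofReal_norm, ← ofReal_norm,
    Lp.norm_fourier_eq]

theorem lintegral_enorm_sq_fourierInv {N : ℕ} (u : L2 N) :
    ∫⁻ ξ, ‖(𝓕⁻ u : L2 N) ξ‖ₑ ^ 2 = ∫⁻ x, ‖u x‖ₑ ^ 2 := by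
  rw [← lintegral_enorm_sq_fourier, FourierTransform.fourier_fourierInv_eq]

/-- Cauchy–Schwarz on a set. -/
theorem sq_setLIntegral_enorm_le {α : Type*} [MeasurableSpace α] {μ : Measure α} (f : Lp ℂ 2 μ)
    (s : Set α) :
    (∫⁻ x in s, ‖f x‖ₑ ∂μ) ^ 2 ≤ μ s * ∫⁻ x in s, ‖f x‖ₑ ^ 2 ∂μ := by
  have h := eLpNorm_le_eLpNorm_mul_rpow_measure_univ (p := 1) (q := 2) (by norm_num)
    ((Lp.memLp f).1.restrict (s := s))
  have h2 := eLpNorm_nnreal_pow_eq_lintegral (f := f) (μ := μ.restrict s) (p := 2) (by norm_num)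
  rw [eLpNorm_one_eq_lintegral_enorm] at h
  calc _ ≤ _ := pow_le_pow_left' h 2
    _ = _ := by
      rw [mul_pow, mul_comm]
      congr 1
      · rw [← ENNReal.rpow_natCast, ← ENNReal.rpow_mul]
        norm_num
      · simpa using h2

/-- A quantitative form of the equi-integrability of `|u|²`: the mass of `u` on a set `A` is
controlled by the measure of `A` and by the mass of `𝓕 u` outside of a set `B`. -/
theorem setLIntegral_enorm_sq_le {N : ℕ} (u : L2 N) (A : Set (Space N)) {B : Set (Space N)}
    (hB : MeasurableSet B) (hBfin : volume B ≠ ∞) :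
    ∫⁻ x in A, ‖u x‖ₑ ^ 2 ≤
      2 * (volume A * volume B * ∫⁻ x, ‖u x‖ₑ ^ 2) + 2 * ∫⁻ ξ in Bᶜ, ‖(𝓕 u : L2 N) ξ‖ₑ ^ 2 := by
  set f : L2 N := 𝓕 u with hf
  have hlow : MemLp (B.indicator f) 2 volume := (Lp.memLp f).indicator hB
  have hhigh : MemLp (Bᶜ.indicator f) 2 volume := (Lp.memLp f).indicator hB.compl
  set fl : L2 N := hlow.toLp _ with hfl
  set fh : L2 N := hhigh.toLp _ with hfh
  have hsum : fl + fh = f := by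
    rw [hfl, hfh, ← MemLp.toLp_add]
    simp [Set.indicator_self_add_compl]
  have hu : u = 𝓕⁻ fl + 𝓕⁻ fh := by
    rw [← FourierTransform.fourierInv_add, hsum, hf, FourierTransform.fourierInv_fourier_eq]
  have hflint : Integrable fl := by
    refine Integrable.congr ?_ hlow.coeFn_toLp.symm
    rw [integrable_indicator_iff hB]
    exact integrableOn_Lp_of_measure_ne_top f (by norm_num) hBfin
  have hfl1 : ∫⁻ ξ, ‖fl ξ‖ₑ = ∫⁻ ξ in B, ‖f ξ‖ₑ := by
    rw [← lintegral_indicator hB]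
    refine lintegral_congr_ae ?_
    filter_upwards [hlow.coeFn_toLp] with ξ h
    rw [h, enorm_indicator_eq_indicator_enorm]
  have hfh2 : ∫⁻ ξ, ‖fh ξ‖ₑ ^ 2 = ∫⁻ ξ in Bᶜ, ‖f ξ‖ₑ ^ 2 := by
    rw [← lintegral_indicator hB.compl]
    refine lintegral_congr_ae ?_
    filter_upwards [hhigh.coeFn_toLp] with ξ h
    rw [h, enorm_indicator_eq_indicator_enorm]
    by_cases hξ : ξ ∈ Bᶜ <;> simp [hξ]
  -- The low-frequency part is bounded pointwise by the `L¹` norm of its transform, the other is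
  -- kept in `L²`.
  have hbound : ∀ᵐ x, ‖u x‖ₑ ^ 2 ≤
      2 * (∫⁻ ξ in B, ‖f ξ‖ₑ) ^ 2 + 2 * ‖(𝓕⁻ fh : L2 N) x‖ₑ ^ 2 := by
    filter_upwards [enorm_fourierInv_ae_le fl hflint, Lp.coeFn_add (𝓕⁻ fl) (𝓕⁻ fh)] with x h1 h2
    rw [← hu] at h2
    rw [h2, Pi.add_apply, ← hfl1, ← mul_add]
    calc _ ≤ (‖(𝓕⁻ fl : L2 N) x‖ₑ + ‖(𝓕⁻ fh : L2 N) x‖ₑ) ^ 2 := by gcongr; exact enorm_add_le _ _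
      _ ≤ 2 * (‖(𝓕⁻ fl : L2 N) x‖ₑ ^ 2 + ‖(𝓕⁻ fh : L2 N) x‖ₑ ^ 2) := by
        have h := ENNReal.rpow_add_le_mul_rpow_add_rpow ‖(𝓕⁻ fl : L2 N) x‖ₑ
          ‖(𝓕⁻ fh : L2 N) x‖ₑ (p := 2) (by norm_num)
        norm_num at h
        exact h
      _ ≤ _ := by gcongr
  calc ∫⁻ x in A, ‖u x‖ₑ ^ 2
      ≤ ∫⁻ x in A, (2 * (∫⁻ ξ in B, ‖f ξ‖ₑ) ^ 2 + 2 * ‖(𝓕⁻ fh : L2 N) x‖ₑ ^ 2) :=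
        lintegral_mono_ae (ae_restrict_of_ae hbound)
    _ = 2 * (volume A * (∫⁻ ξ in B, ‖f ξ‖ₑ) ^ 2) + 2 * ∫⁻ x in A, ‖(𝓕⁻ fh : L2 N) x‖ₑ ^ 2 := by
        rw [lintegral_add_left (by fun_prop), setLIntegral_const, mul_assoc, mul_comm (volume A),
          lintegral_const_mul' _ _ (by norm_num)]
    _ ≤ 2 * (volume A * (volume B * ∫⁻ ξ, ‖f ξ‖ₑ ^ 2)) + 2 * ∫⁻ x, ‖(𝓕⁻ fh : L2 N) x‖ₑ ^ 2 := by
        gcongr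
        · exact (sq_setLIntegral_enorm_le f B).trans (by gcongr; exact Measure.restrict_le_self)
        · exact Measure.restrict_le_self
    _ = _ := by
        rw [lintegral_enorm_sq_fourierInv, hfh2, hf, lintegral_enorm_sq_fourier, mul_assoc]



/-! ### The symbol and the quadratic form of the operator -/

theorem symbol_zero_pos {N : ℕ} {m : ℝ} (hm : 0 < m) : 0 < symbol m (0 : Space N) := by
  unfold symbol
  positivity

theorem symbol_zero_le {N : ℕ} (m : ℝ) (ξ : Space N) : symbol m (0 : Space N) ≤ symbol m ξ := by
  unfold symbol
  gcongr
  simp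

theorem le_symbol_of_sq_le_norm {N : ℕ} (m : ℝ) {L : ℝ} (hL : 0 ≤ L) {ξ : Space N}
    (hξ : L ^ 2 ≤ ‖ξ‖) : L ≤ symbol m ξ := by
  have hpi : ‖ξ‖ ≤ 2 * Real.pi * ‖ξ‖ := by
    nlinarith [Real.pi_gt_three, norm_nonneg ξ]
  calc L = (L ^ 4) ^ (1 / 4 : ℝ) := by
        rw [← Real.rpow_natCast, ← Real.rpow_mul hL]
        norm_num
    _ ≤ symbol m ξ := by
        unfold symbol
        gcongr
        nlinarith [pow_le_pow_left₀ (sq_nonneg L) (hξ.trans hpi) 2, sq_nonneg m]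

/-- The quadratic form `⟨u, (-Δ + m²)^{1/4} u⟩`, on the Fourier side. -/
noncomputable def quarterEnergy {N : ℕ} (m : ℝ) (u : L2 N) : ℝ≥0∞ :=
  ∫⁻ ξ, ENNReal.ofReal (symbol m ξ) * ‖(𝓕 u : L2 N) ξ‖ₑ ^ 2

/-- Parseval. The pairing on the right lives in physical space, where the vanishing of `u` outside a
set can be used; it also shows that the energy is finite. -/
theorem MemBessel.quarterEnergy_eq {N : ℕ} (m : ℝ) {u : L2 N} (hu : MemBessel u) :
    quarterEnergy m u = ‖inner ℂ u (rootOp m u)‖ₑ := by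
  have h := hu.memLp_symbol_mul m
  have h0 : ∀ ξ : Space N, 0 ≤ symbol m ξ := fun ξ => by unfold symbol; positivity
  have hroot : rootOp m u = 𝓕⁻ (h.toLp _) := dif_pos h
  rw [hroot, ← Lp.inner_fourier_eq, FourierTransform.fourier_fourierInv_eq, L2.inner_def]
  have hae : (fun ξ => inner ℂ ((𝓕 u : L2 N) ξ) ((h.toLp _ : L2 N) ξ)) =ᵐ[volume]
      fun ξ => ((symbol m ξ * ‖(𝓕 u : L2 N) ξ‖ ^ 2 : ℝ) : ℂ) := by
    filter_upwards [h.coeFn_toLp] with ξ hξ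
    rw [hξ, RCLike.inner_apply, mul_assoc, Complex.mul_conj']
    push_cast
    rfl
  have hint : Integrable (fun ξ => symbol m ξ * ‖(𝓕 u : L2 N) ξ‖ ^ 2) := by
    have := ((L2.integrable_inner (𝕜 := ℂ) (𝓕 u : L2 N) (h.toLp _)).congr hae).re
    exact this.congr (ae_of_all _ fun ξ => Complex.ofReal_re _)
  rw [integral_congr_ae hae, integral_complex_ofReal, ← ofReal_norm, Complex.norm_real,
    Real.norm_of_nonneg (integral_nonneg fun ξ => mul_nonneg (h0 ξ) (sq_nonneg _)),
    ofReal_integral_eq_lintegral_ofReal hint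
      (ae_of_all _ fun ξ => mul_nonneg (h0 ξ) (sq_nonneg _))]
  refine lintegral_congr fun ξ => ?_
  rw [ENNReal.ofReal_mul (h0 ξ), ENNReal.ofReal_pow (norm_nonneg _), ofReal_norm]

/-- If `u` vanishes outside of `Ω`, then `⟨u, (-Δ + m²)^{1/4} u⟩` only sees
`(-Δ + m²)^{1/4} u` on `Ω`. -/
theorem MemBessel.quarterEnergy_sq_le {N : ℕ} (m : ℝ) {u : L2 N} (hu : MemBessel u)
    {Ω : Set (Space N)} (hΩ : MeasurableSet Ω) (hzero : ∀ᵐ x, x ∉ Ω → u x = 0) :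
    quarterEnergy m u ^ 2 ≤ (∫⁻ x, ‖u x‖ₑ ^ 2) * kinetic m Ω u := by
  have hw : MemLp (Ω.indicator (rootOp m u)) 2 volume := (Lp.memLp _).indicator hΩ
  -- Cutting `rootOp m u` off to `Ω` does not change the pairing, since `u` vanishes elsewhere.
  have hinner : inner ℂ u (rootOp m u) = inner ℂ u (hw.toLp _) := by
    rw [L2.inner_def, L2.inner_def]
    refine integral_congr_ae ?_
    filter_upwards [hzero, hw.coeFn_toLp] with x hx hwx
    rw [hwx]
    by_cases hxΩ : x ∈ Ω
    · simp [hxΩ]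
    · simp [hx hxΩ]
  have hkin : ‖(hw.toLp _ : L2 N)‖ₑ ^ 2 = kinetic m Ω u := by
    rw [enorm_sq_eq_lintegral, kinetic, ← lintegral_indicator hΩ]
    refine lintegral_congr_ae ?_
    filter_upwards [hw.coeFn_toLp] with x hx
    rw [hx]
    by_cases hxΩ : x ∈ Ω <;> simp [hxΩ]
  rw [hu.quarterEnergy_eq, hinner, ← hkin, ← enorm_sq_eq_lintegral, ← mul_pow]
  gcongr
  rw [← ofReal_norm, ← ofReal_norm, ← ofReal_norm, ← ENNReal.ofReal_mul (norm_nonneg _)]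
  exact ENNReal.ofReal_le_ofReal (norm_inner_le_norm _ _)

theorem symbol_zero_mul_lintegral_le {N : ℕ} (m : ℝ) (u : L2 N) :
    ENNReal.ofReal (symbol m (0 : Space N)) * ∫⁻ x, ‖u x‖ₑ ^ 2 ≤ quarterEnergy m u := by
  rw [← lintegral_enorm_sq_fourier, ← lintegral_const_mul' _ _ ENNReal.ofReal_ne_top]
  exact lintegral_mono fun ξ => by
    gcongr
    exact symbol_zero_le m ξ

theorem mul_setLIntegral_compl_ball_le {N : ℕ} (m : ℝ) {L : ℝ} (hL : 0 ≤ L) (u : L2 N) :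
    ENNReal.ofReal L * ∫⁻ ξ in (Metric.ball 0 (L ^ 2))ᶜ, ‖(𝓕 u : L2 N) ξ‖ₑ ^ 2 ≤
      quarterEnergy m u := by
  rw [← lintegral_const_mul' _ _ ENNReal.ofReal_ne_top]
  refine (setLIntegral_mono' Metric.isOpen_ball.measurableSet.compl fun ξ hξ => ?_).trans
    (setLIntegral_le_lintegral _ _)
  gcongr
  exact le_symbol_of_sq_le_norm m hL (by simpa using hξ)

/-- With `q` the energy and `c = symbol m 0`, Cauchy–Schwarz on `Ω` gives `c q² ≤ c ‖u‖² · kinetic ≤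
q · kinetic`, and a factor `q` cancels. -/
theorem MemBessel.symbol_zero_mul_quarterEnergy_le {N : ℕ} (m : ℝ) {u : L2 N} (hu : MemBessel u)
    {Ω : Set (Space N)} (hΩ : MeasurableSet Ω) (hzero : ∀ᵐ x, x ∉ Ω → u x = 0) :
    ENNReal.ofReal (symbol m (0 : Space N)) * quarterEnergy m u ≤ kinetic m Ω u := by
  rcases eq_or_ne (quarterEnergy m u) 0 with h0 | h0
  · simp [h0]
  have htop : quarterEnergy m u ≠ ∞ := by
    rw [hu.quarterEnergy_eq]
    exact enorm_ne_top
  rw [← ENNReal.mul_le_mul_iff_right h0 htop]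
  calc quarterEnergy m u * (ENNReal.ofReal (symbol m (0 : Space N)) * quarterEnergy m u)
      = ENNReal.ofReal (symbol m (0 : Space N)) * quarterEnergy m u ^ 2 := by ring
    _ ≤ ENNReal.ofReal (symbol m (0 : Space N)) * ((∫⁻ x, ‖u x‖ₑ ^ 2) * kinetic m Ω u) := by
        gcongr
        exact hu.quarterEnergy_sq_le m hΩ hzero
    _ ≤ quarterEnergy m u * kinetic m Ω u := by
        rw [← mul_assoc]
        gcongr
        exact symbol_zero_mul_lintegral_le m u

/-! ### Small sets carry little mass -/

/-- On sets of small measure the mass of `u` is small compared with its kinetic energy, even if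
the latter is only taken over a set `Ω` outside of which `u` vanishes. -/
theorem exists_measure_le_imp_mul_setLIntegral_le_kinetic (N : ℕ) {m : ℝ} (hm : 0 < m) {M : ℝ}
    (hM : 0 ≤ M) :
    ∃ δ : ℝ≥0∞, 0 < δ ∧ ∀ A : Set (Space N), volume A ≤ δ → ∀ u : L2 N, MemBessel u →
      ∀ Ω : Set (Space N), MeasurableSet Ω → (∀ᵐ x, x ∉ Ω → u x = 0) →
        ENNReal.ofReal M * ∫⁻ x in A, ‖u x‖ₑ ^ 2 ≤ kinetic m Ω u := by
  set c : ℝ := symbol m (0 : Space N) with hc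
  have hc0 : 0 < c := symbol_zero_pos hm
  -- Chosen so that `c L = 4 M`, where the symbol is at least `L` outside the ball of radius `L²`.
  set L : ℝ := 4 * M / c with hL
  have hL0 : 0 ≤ L := by positivity
  set B : Set (Space N) := Metric.ball 0 (L ^ 2) with hBdef
  have hBfin : volume B ≠ ∞ := measure_ball_lt_top.ne
  -- `δ` makes the low-frequency term at most `c² ‖u‖²`, which is itself bounded by the kinetic
  -- energy.
  obtain ⟨δ, hδ, hδB⟩ := ENNReal.exists_nnreal_pos_mul_lt
    (a := 4 * ENNReal.ofReal M * volume B) (b := ENNReal.ofReal c ^ 2)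
    (by finiteness) (by positivity)
  refine ⟨δ, by exact_mod_cast hδ, fun A hA u hu Ω hΩ hzero => ?_⟩
  have hS := hu.symbol_zero_mul_quarterEnergy_le m hΩ hzero
  have hcL : ENNReal.ofReal c * ENNReal.ofReal L = 4 * ENNReal.ofReal M := by
    rw [← ENNReal.ofReal_mul hc0.le, hL, mul_div_cancel₀ _ hc0.ne', ENNReal.ofReal_mul (by norm_num)]
    norm_num
  have hq : ENNReal.ofReal c ^ 2 * ∫⁻ x, ‖u x‖ₑ ^ 2 ≤ kinetic m Ω u := by
    rw [sq, mul_assoc]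
    exact (mul_le_mul_right (symbol_zero_mul_lintegral_le m u) _).trans hS
  have hH : 4 * ENNReal.ofReal M * ∫⁻ ξ in Bᶜ, ‖(𝓕 u : L2 N) ξ‖ₑ ^ 2 ≤ kinetic m Ω u := by
    rw [← hcL, mul_assoc]
    exact (mul_le_mul_right (mul_setLIntegral_compl_ball_le m hL0 u) _).trans hS
  -- After doubling, the low and the high frequencies may each cost one full kinetic energy.
  rw [← ENNReal.mul_le_mul_iff_right (a := 2) (by norm_num) (by norm_num)]
  calc 2 * (ENNReal.ofReal M * ∫⁻ x in A, ‖u x‖ₑ ^ 2)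
      ≤ 2 * (ENNReal.ofReal M * (2 * (volume A * volume B * ∫⁻ x, ‖u x‖ₑ ^ 2) +
          2 * ∫⁻ ξ in Bᶜ, ‖(𝓕 u : L2 N) ξ‖ₑ ^ 2)) := by
        gcongr
        exact setLIntegral_enorm_sq_le u A Metric.isOpen_ball.measurableSet hBfin
    _ = volume A * (4 * ENNReal.ofReal M * volume B) * (∫⁻ x, ‖u x‖ₑ ^ 2) +
          4 * ENNReal.ofReal M * ∫⁻ ξ in Bᶜ, ‖(𝓕 u : L2 N) ξ‖ₑ ^ 2 := by ring
    _ ≤ ENNReal.ofReal c ^ 2 * (∫⁻ x, ‖u x‖ₑ ^ 2) +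
          4 * ENNReal.ofReal M * ∫⁻ ξ in Bᶜ, ‖(𝓕 u : L2 N) ξ‖ₑ ^ 2 := by
        gcongr
        exact (mul_le_mul_left hA _).trans hδB.le
    _ ≤ kinetic m Ω u + kinetic m Ω u := add_le_add hq hH
    _ = 2 * kinetic m Ω u := (two_mul _).symm

/-! ### Lower bounds for the quotients -/

/-- A lower bound for the quotients that define `nu` and `nuZero`. -/
theorem le_quotient {N : ℕ} {V : Space N → ℝ} (hV : Measurable V) {b c : ℝ} (hb : 0 ≤ b)
    (hc : 0 ≤ c) (hVc : ∀ x, -c ≤ V x) {Ω : Set (Space N)} {u : Space N → ℂ}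
    (hu : MemLp u 2 (volume.restrict Ω)) (hne : ∫⁻ x in Ω, ‖u x‖ₑ ^ 2 ≠ 0) {k : ℝ≥0∞}
    (hk : ENNReal.ofReal (b + c) * ∫⁻ x in {x | V x < b} ∩ Ω, ‖u x‖ₑ ^ 2 ≤ k) :
    (b : EReal) ≤ ((k : EReal) + potential V Ω u) / (sqNorm 2 Ω u : EReal) := by
  have hum : AEMeasurable (fun x => ‖u x‖ₑ ^ 2) (volume.restrict Ω) := hu.1.enorm.pow_const 2
  have hsq : sqNorm 2 Ω u = ∫⁻ x in Ω, ‖u x‖ₑ ^ 2 := by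
    simp [sqNorm]
  have hfin : ∫⁻ x in Ω, ‖u x‖ₑ ^ 2 ≠ ∞ := by
    have := enorm_sq_eq_lintegral (hu.toLp u)
    rw [lintegral_congr_ae (g := fun x => ‖u x‖ₑ ^ 2)
      (hu.coeFn_toLp.mono fun x hx => by simp only [hx])] at this
    rw [← this]
    finiteness
  have hA : MeasurableSet {x | V x < b} := measurableSet_lt hV measurable_const
  set s := ∫⁻ x in Ω, ‖u x‖ₑ ^ 2 with hs
  set P := ∫⁻ x in Ω, ENNReal.ofReal (V x) * ‖u x‖ₑ ^ 2 with hP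
  set Q := ∫⁻ x in Ω, ENNReal.ofReal (-V x) * ‖u x‖ₑ ^ 2 with hQ
  have hQfin : Q ≠ ∞ := by
    refine ne_top_of_le_ne_top (b := ENNReal.ofReal c * s) (by finiteness) ?_
    rw [hs, ← lintegral_const_mul' _ _ ENNReal.ofReal_ne_top]
    exact lintegral_mono fun x => by
      gcongr
      linarith [hVc x]
  -- The desired bound `b s ≤ k + (P - Q)` without subtraction, so that it can be proved in `[0,
  -- ∞]`, even for `P = ∞`; finiteness of `Q` allows the return to `EReal`.
  have hmain : ENNReal.ofReal b * s + Q ≤ k + P := by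
    calc ENNReal.ofReal b * s + Q
        = ∫⁻ x in Ω, (ENNReal.ofReal b * ‖u x‖ₑ ^ 2 + ENNReal.ofReal (-V x) * ‖u x‖ₑ ^ 2) := by
          rw [lintegral_add_left' (hum.const_mul _), lintegral_const_mul' _ _ ENNReal.ofReal_ne_top]
      -- Pointwise, `b + V⁻ ≤ (b + c) 1_{V < b} + V⁺`, where `V⁺` and `V⁻` are the positive and
      -- negative parts of `V`.
      _ ≤ ∫⁻ x in Ω, ({x | V x < b}.indicator (fun x => ENNReal.ofReal (b + c) * ‖u x‖ₑ ^ 2) x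
            + ENNReal.ofReal (V x) * ‖u x‖ₑ ^ 2) := by
          refine lintegral_mono fun x => ?_
          by_cases hx : V x < b
          · simp only [Set.indicator_of_mem (show x ∈ {x | V x < b} from hx), ← add_mul]
            refine mul_le_mul_left ?_ _
            rcases le_total 0 (V x) with h | h
            · rw [ENNReal.ofReal_of_nonpos (neg_nonpos.mpr h), add_zero]
              exact (ENNReal.ofReal_le_ofReal (by linarith)).trans le_self_add
            · rw [ENNReal.ofReal_of_nonpos h, add_zero,
                ← ENNReal.ofReal_add hb (neg_nonneg.mpr h)]
              exact ENNReal.ofReal_le_ofReal (by linarith [hVc x])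
          · have hbV : b ≤ V x := not_lt.mp hx
            simp only [Set.indicator_of_notMem (show x ∉ {x | V x < b} from hx), zero_add,
              ENNReal.ofReal_of_nonpos (neg_nonpos.mpr (hb.trans hbV)), zero_mul, add_zero]
            gcongr
      _ = ENNReal.ofReal (b + c) * (∫⁻ x in {x | V x < b} ∩ Ω, ‖u x‖ₑ ^ 2) + P := by
          rw [lintegral_add_left' ((hum.const_mul _).indicator hA), lintegral_indicator hA,
            Measure.restrict_restrict hA, lintegral_const_mul' _ _ ENNReal.ofReal_ne_top]
      _ ≤ k + P := by gcongr
  rw [hsq, EReal.le_div_iff_mul_le (by exact_mod_cast hne.bot_lt) (by simpa using hfin),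
    potential, ← hP, ← hQ, sub_eq_add_neg, ← add_assoc, ← sub_eq_add_neg,
    EReal.le_sub_iff_add_le (Or.inl (EReal.coe_ennreal_ne_bot _))
      (Or.inl (by simpa using hQfin))]
  have hbE : (b : EReal) = (ENNReal.ofReal b : ℝ≥0∞) := by
    rw [EReal.coe_ennreal_ofReal, max_eq_left hb]
  rw [hbE]
  exact_mod_cast hmain

theorem tendsto_measure_inter_compl_closedBall {N : ℕ} {s : Set (Space N)} (hs : MeasurableSet s)
    (hfin : volume s ≠ ∞) :
    Tendsto (fun R : ℝ => volume (s ∩ (Metric.closedBall 0 R)ᶜ)) atTop (𝓝 0) := by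
  have h := tendsto_measure_iInter_atTop (μ := volume)
    (s := fun R : ℝ => s ∩ (Metric.closedBall (0 : Space N) R)ᶜ)
    (fun R => (hs.inter Metric.isClosed_closedBall.measurableSet.compl).nullMeasurableSet)
    (fun R R' hR => Set.inter_subset_inter_right _
      (Set.compl_subset_compl.mpr (Metric.closedBall_subset_closedBall hR)))
    ⟨0, measure_ne_top_of_subset Set.inter_subset_left hfin⟩
  have hempty : ⋂ R : ℝ, s ∩ (Metric.closedBall (0 : Space N) R)ᶜ = ∅ := by
    refine Set.eq_empty_of_forall_notMem fun x hx => ?_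
    exact (Set.mem_iInter.mp hx ‖x‖).2 (by simp)
  rwa [hempty, measure_empty] at h

theorem le_nu {N : ℕ} {m b c : ℝ} {V : Space N → ℝ} (hV : Measurable V) (hb : 0 ≤ b)
    (hc : 0 ≤ c) (hVc : ∀ x, -c ≤ V x) {Ω : Set (Space N)}
    (h : ∀ u : L2 N, MemBessel u →
      ENNReal.ofReal (b + c) * ∫⁻ x in {x | V x < b} ∩ Ω, ‖u x‖ₑ ^ 2 ≤ kinetic m Set.univ u) :
    (b : EReal) ≤ nu m V 2 Ω := by
  refine le_iInf₂ fun u hu => le_quotient hV hb hc hVc (Lp.memLp u) ?_ ?_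
  · rw [← enorm_sq_eq_lintegral]
    simpa using hu.2
  · refine le_iInf₂ fun U hU => ?_
    -- Every extension `U` agrees with `u` on `Ω`, so the mass to be controlled is the same for all
    -- of them.
    rw [← lintegral_congr_ae (ae_restrict_of_ae_restrict_of_subset Set.inter_subset_right
      (hU.2.mono fun x hx => by simp only [hx] : ∀ᵐ x ∂volume.restrict Ω,
        ‖U x‖ₑ ^ 2 = ‖u x‖ₑ ^ 2))]
    exact h U hU.1

theorem le_nuZero {N : ℕ} {m b c : ℝ} {V : Space N → ℝ} (hV : Measurable V) (hb : 0 ≤ b)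
    (hc : 0 ≤ c) (hVc : ∀ x, -c ≤ V x) {Ω : Set (Space N)} (hΩ : MeasurableSet Ω)
    (h : ∀ u : L2 N, MemBessel u → (∀ᵐ x, x ∉ Ω → u x = 0) →
      ENNReal.ofReal (b + c) * ∫⁻ x in {x | V x < b} ∩ Ω, ‖u x‖ₑ ^ 2 ≤ kinetic m Ω u) :
    (b : EReal) ≤ nuZero m V 2 Ω := by
  refine le_iInf₂ fun u ⟨hu, hzero, hne⟩ => le_quotient hV hb hc hVc ((Lp.memLp u).restrict Ω) ?_
    (h u hu hzero)
  have : ∫⁻ x in Ω, ‖u x‖ₑ ^ 2 = ∫⁻ x, ‖u x‖ₑ ^ 2 := by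
    rw [← lintegral_indicator hΩ]
    refine lintegral_congr_ae (hzero.mono fun x hx => ?_)
    by_cases hxΩ : x ∈ Ω
    · simp [hxΩ]
    · simp [hxΩ, hx hxΩ]
  rw [this, ← enorm_sq_eq_lintegral]
  simpa using hne

theorem eventually_le_nu_and_le_nuZero {N : ℕ} {m : ℝ} (hm : 0 < m) {V : Space N → ℝ}
    (hV : Measurable V) {b c : ℝ} (hb : 0 ≤ b) (hc : 0 ≤ c) (hVc : ∀ x, -c ≤ V x)
    (hfin : volume {x | V x < b} ≠ ∞) :
    ∀ᶠ R : ℝ in atTop, (b : EReal) ≤ nu m V 2 (Metric.closedBall 0 R)ᶜ ∧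
      (b : EReal) ≤ nuZero m V 2 (Metric.closedBall 0 R)ᶜ := by
  obtain ⟨δ, hδ, h⟩ :=
    exists_measure_le_imp_mul_setLIntegral_le_kinetic N hm (add_nonneg hb hc)
  filter_upwards [(tendsto_measure_inter_compl_closedBall
    (measurableSet_lt hV measurable_const) hfin).eventually_le_const hδ] with R hR
  have hΩ : MeasurableSet (Metric.closedBall (0 : Space N) R)ᶜ :=
    Metric.isClosed_closedBall.measurableSet.compl
  -- For `nu` the extensions carry their energy on the whole space, so the vanishing condition is
  -- void.
  exact ⟨le_nu hV hb hc hVc fun u hu =>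
      h _ hR u hu Set.univ MeasurableSet.univ (ae_of_all _ fun x hx => absurd (Set.mem_univ x) hx),
    le_nuZero hV hb hc hVc hΩ fun u hu hzero => h _ hR u hu _ hΩ hzero⟩

end Semirelativistic

theorem proposition3p4 (N : ℕ) (hN : 1 < N) (m : ℝ) (hm : 0 < m)
    (V : Semirelativistic.Space N → ℝ) (hVcont : Continuous V) (hVbdd : BddBelow (Set.range V))
    (hV : ∀ b : ℝ, 0 < b → volume {x | V x < b} < ⊤) :
    ∃ t₀ : ℝ, 2 ≤ t₀ ∧ t₀ < 2 * (N : ℝ) / ((N : ℝ) - 1) ∧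
      Tendsto (fun R : ℝ => Semirelativistic.nu m V t₀ (Metric.closedBall 0 R)ᶜ) atTop (𝓝 ⊤) ∧
      Tendsto (fun R : ℝ => Semirelativistic.nuZero m V t₀ (Metric.closedBall 0 R)ᶜ)
        atTop (𝓝 ⊤) := by
  have hN1 : (1 : ℝ) < N := by exact_mod_cast hN
  obtain ⟨a, ha⟩ := hVbdd
  have hlower : ∀ x, -|a| ≤ V x := fun x => (neg_abs_le a).trans (ha (Set.mem_range_self x))
  have hev : ∀ y : ℝ, ∀ᶠ R : ℝ in atTop,
      (y : EReal) < Semirelativistic.nu m V 2 (Metric.closedBall 0 R)ᶜ ∧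
      (y : EReal) < Semirelativistic.nuZero m V 2 (Metric.closedBall 0 R)ᶜ := fun y => by
    -- A level above `y` that is positive, as the hypothesis on the sublevel sets requires.
    have hb : 0 < |y| + 1 := by positivity
    have hlt : (y : EReal) < ((|y| + 1 : ℝ) : EReal) := by
      exact_mod_cast (le_abs_self y).trans_lt (lt_add_one _)
    exact (Semirelativistic.eventually_le_nu_and_le_nuZero hm hVcont.measurable hb.le (abs_nonneg a)
      hlower (hV _ hb).ne).mono fun R h => ⟨hlt.trans_le h.1, hlt.trans_le h.2⟩
  refine ⟨2, le_rfl, ?_, EReal.tendsto_nhds_top_iff_real.mpr fun y => (hev y).mono fun _ h => h.1,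
    EReal.tendsto_nhds_top_iff_real.mpr fun y => (hev y).mono fun _ h => h.2⟩
  -- `2 < 2N / (N - 1)` amounts to `2N - 2 < 2N`.
  rw [lt_div_iff₀ (by linarith)]
  linarith
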